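/- Fix integers $p_1,p_2\ge 0$, $p=p_1+p_2$, $\sigma>0$, and $\beta=(\beta_1',\beta_2')'\in\mathbb R^p$, where all $p_1$ components of $\beta_1$ are nonzero and $\beta_2=0\in\mathbb R^{p_2}$. For each sample size $n$ let $Y=X\beta+\varepsilon$, where $X=X_n=(X_1\ X_2)$ is a nonrandom $n\times p$ matrix ($X_1$ being its first $p_1$ columns) and $\varepsilon\sim N(0,\sigma^2I_n)$. Assume: 1. As $n\to\infty$, $X'X/n\to\Sigma$ with $\Sigma$ positive definite; let $\Sigma_1$ be the upper left $p_1\times p_1$ block of $\Sigma$. For every $n\ge1$ all diagonal entries of $X'X/n$ are $1$, and there are a matrix $\Delta=\Delta_n$ with $p$ columns and a number $d=d_n$ with $X'X/n+\Delta'\Delta=d\,I_p$ and $d\ge\gamma_1$, where $\gamma_1$ is the largest eigenvalue of $X'X/n$; moreover $d_n=O(1)$. 2. The tuning parameters $\lambda_n$ satisfy $\lambda_n/n\to0$ and $\lambda_n/\sqrt n\to\infty$. 3. With $\eta=\eta_n$ the largest eigenvalue of $I_{p_1}-X_1'X_1/(nd)$ (put $\eta=0$ if $p_1=0$), the iteration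 counts $k_n\in\{0,1,2,\dots\}$ satisfy $\eta_n^{k_n}\lambda_n/\sqrt n\to0$ and $k_n^2\exp\{-c(\lambda_n/\sqrt n)^2\}\to0$ for every $c>0$. Given a function $s(\cdot\,;\lambda)$ on $\mathbb R$, the OEM sequence is $\beta^{(0)}=(X'X)^{-1}X'Y$ (which exists for all large $n$) and $$\beta^{(k+1)}_j=s\bigl(u^{(k)}_j;\lambda_n/n\bigr),\quad j=1,\dots,p,\qquad u^{(k)}=\frac{X'Y}{n}+\Delta'\Delta\,\beta^{(k)}.$$ For the SCAD penalty with parameter $a>2$, $$s(u;\lambda)=\begin{cases}\operatorname{sign}(u)(|u|-\lambda)_+/d,&|u|\le(d+1)\lambda,\\ \operatorname{sign}(u)\{(a-1)|u|-a\lambda\}/\{(a-1)d-1\},&(d+1)\lambda<|u|\le ad\lambda,\\ u/d,&|u|>ad\lambda,\end{cases}$$ and for the MCP with parameter $a>1$, $$s(u;\lambda)=\begin{cases}\operatorname{sign}(u)\,a\,(|u|-\lambda)_+/(ad-1),&|u|\le ad\lambda,\\ u/d,&|u|>ad\lambda.\end{cases}$$ Then, for the OEM sequence of the SCAD with any fixed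 $a>2$, and likewise for that of the MCP with any fixed $a>1$, writing $\beta^{(k)}=(\beta_1^{(k)\prime},\beta_2^{(k)\prime})'$, as $n\to\infty$: (i) $P(\beta_2^{(k_n)}=0)\to1$; (ii) $\sqrt n\,(\beta_1^{(k_n)}-\beta_1)\to N(0,\sigma^2\Sigma_1^{-1})$ in distribution. -/

import Mathlib

open MeasureTheory ProbabilityTheory Filter Matrix
open scoped Topology

noncomputable section

/-- The normalized Gram matrix `X'X / n` of an `n`-row regression matrix `X`. -/
def normGram {n : ℕ} {ι : Type*} (X : Matrix (Fin n) ι ℝ) : Matrix ι ι ℝ :=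
  (n : ℝ)⁻¹ • (Xᵀ * X)

/-- The largest eigenvalue of a real (symmetric) matrix. -/
def maxEigenvalue {ι : Type*} [Fintype ι] [DecidableEq ι] (A : Matrix ι ι ℝ) : ℝ :=
  sSup {μ : ℝ | Module.End.HasEigenvalue (Matrix.toLin' A) μ}

/-- The closed-form one-dimensional OEM update for the SCAD penalty with parameters `a` and `lam`:
for `d ≥ 1`, the minimizer over `t` of `d t² - 2 u t + 2 P_lam(|t|)`, where
`P_lam'(θ) = lam · 1(θ ≤ lam) + (a lam - θ)₊ · 1(θ > lam) / (a - 1)`. -/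
def scadUpdate (a lam d u : ℝ) : ℝ :=
  if |u| ≤ (d + 1) * lam then Real.sign u * max (|u| - lam) 0 / d
  else if |u| ≤ a * lam * d then Real.sign u * ((a - 1) * |u| - a * lam) / ((a - 1) * d - 1)
  else u / d

/-- The closed-form one-dimensional OEM update for the MCP with parameters `a` and `lam`:
for `d ≥ 1`, the minimizer over `t` of `d t² - 2 u t + 2 P_lam(|t|)`, where
`P_lam'(θ) = (lam - θ / a) · 1(θ ≤ a lam)`. -/
def mcpUpdate (a lam d u : ℝ) : ℝ :=
  if |u| ≤ a * lam * d then Real.sign u * a * max (|u| - lam) 0 / (a * d - 1)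
  else u / d

/-- The ordinary least squares estimator `(X'X)⁻¹ X'Y`. -/
def ols {n : ℕ} {ι : Type*} [Fintype ι] [DecidableEq ι]
    (X : Matrix (Fin n) ι ℝ) (Y : Fin n → ℝ) : ι → ℝ :=
  (Xᵀ * X)⁻¹ *ᵥ (Xᵀ *ᵥ Y)

/-- The vector `u = X'Y / n + Δ'Δ b` entering the OEM update at the current iterate `b`, for the
regression matrix `X / √n` and response `Y / √n` completed by the rows of `Δ`. -/
def oemVec {n m : ℕ} {ι : Type*} [Fintype ι]
    (X : Matrix (Fin n) ι ℝ) (Δ : Matrix (Fin m) ι ℝ) (Y : Fin n → ℝ) (b : ι → ℝ) : ι → ℝ :=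
  (n : ℝ)⁻¹ • (Xᵀ *ᵥ Y) + (Δᵀ * Δ) *ᵥ b

/-- The OEM sequence started at the ordinary least squares estimator; `s` is the coordinatewise
update. -/
def oemSeq {n m : ℕ} {ι : Type*} [Fintype ι] [DecidableEq ι] (s : ℝ → ℝ)
    (X : Matrix (Fin n) ι ℝ) (Δ : Matrix (Fin m) ι ℝ) (Y : Fin n → ℝ) : ℕ → ι → ℝ
  | 0 => ols X Y
  | k + 1 => fun j => s (oemVec X Δ Y (oemSeq s X Δ Y k) j)

/-- The oracle property of a sequence of estimators `b n` of `β = (β₁, β₂)`, where the index set of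
`β₁` is `Fin p₁` and that of `β₂` is `Fin p₂`: `P(b₂ = 0) → 1`, and `√n (b₁ - β₁)` converges in
distribution to `N(0, σ² Σ₁⁻¹)`, with `Σ₁` the upper left block of `S`. -/
def OracleProperty {p₁ p₂ : ℕ} {Ω : ℕ → Type*} [∀ n, MeasurableSpace (Ω n)]
    (P : ∀ n, Measure (Ω n)) [∀ n, IsProbabilityMeasure (P n)]
    (S : Matrix (Fin p₁ ⊕ Fin p₂) (Fin p₁ ⊕ Fin p₂) ℝ) (σ : ℝ) (β : Fin p₁ ⊕ Fin p₂ → ℝ)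
    (b : ∀ n, Ω n → Fin p₁ ⊕ Fin p₂ → ℝ) : Prop :=
  Tendsto (fun n => P n {ω | ∀ j : Fin p₂, b n ω (Sum.inr j) = 0}) atTop (𝓝 1) ∧
  TendstoInDistribution
    (fun (n : ℕ) ω => √(n : ℝ) • WithLp.toLp 2
      (fun j : Fin p₁ => b n ω (Sum.inl j) - β (Sum.inl j)))
    atTop (id : EuclideanSpace ℝ (Fin p₁) → EuclideanSpace ℝ (Fin p₁)) P
    (multivariateGaussian 0 (σ ^ 2 • (S.toBlocks₁₁)⁻¹))

end

/-! Write `G = X'X/n`, `w = X'ε/n`, and index blocks by 1, 2. Since `Δ'Δ = d I - G`, the update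
vector at an iterate `b` is `d b + w - G (b - β)`. On the single event `‖w‖ ≤ c λ/n`, with `c` a
small constant, every iteration behaves deterministically once `n` is large: the second block of the
update vector stays in the dead zone `[-λ/n, λ/n]` and is set to 0, while the first block, close to
`d β₁` with `β₁` free of zeros and `λ/n → 0`, stays where the rule is `u ↦ u/d`. The event has
probability tending to 1 because `√n w` is asymptotically Gaussian, hence tight, and `λ/√n → ∞`.

On this event the first-block error follows an affine recursion with linear part `A = I - G₁₁/d` and
fixed point `z = G₁₁⁻¹ w₁`, the error of the oracle least squares estimator. It starts at the OLS
error, but the first iteration only kills the second block, so after `k` iterations the deviation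
from `z` carries `A^(k-1)`, not `A^k`. The missing power is partly recovered from the start: OLS and
oracle differ through `G₁₂`, whose norm is `O(√η)` because `Δ'Δ` is positive semidefinite. In total
`η^(k-1) √η ≤ √(η^k) → 0`, so `√n (β₁^(k) - β₁)` has the Gaussian limit of `√n z`.

`oemSeq_succ_eq` gives the deterministic formula, `norm_ols_sub_oracle_le` the factor `√η`, and
`oracleProperty_of_eventually` turns bounds on the event into limit laws. -/

/-! ### Convergence in distribution over varying probability spaces -/

/-- Convergence in distribution only depends on the laws. -/
theorem tendstoInDistribution_comp_measurePreserving {ι E Ω' : Type*} {Ω Ω₂ : ι → Type*}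
    [∀ i, MeasurableSpace (Ω i)] [∀ i, MeasurableSpace (Ω₂ i)]
    {P : ∀ i, Measure (Ω i)} [∀ i, IsProbabilityMeasure (P i)]
    {Q : ∀ i, Measure (Ω₂ i)} [∀ i, IsProbabilityMeasure (Q i)]
    [MeasurableSpace Ω'] {μ' : Measure Ω'} [IsProbabilityMeasure μ']
    [MeasurableSpace E] [TopologicalSpace E] [OpensMeasurableSpace E]
    {U : ∀ i, Ω i → E} {Z : Ω' → E} {l : Filter ι} {π : ∀ i, Ω₂ i → Ω i}
    (hπ : ∀ i, MeasurePreserving (π i) (Q i) (P i))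
    (hU : ∀ i, AEMeasurable (U i) (P i)) :
    TendstoInDistribution (fun i => U i ∘ π i) l Z Q μ' ↔
      TendstoInDistribution U l Z P μ' := by
  have key : ∀ i, (Q i).map (U i ∘ π i) = (P i).map (U i) := fun i => by
    rw [← AEMeasurable.map_map_of_aemeasurable (by rw [(hπ i).map_eq]; exact hU i)
      (hπ i).aemeasurable, (hπ i).map_eq]
  constructor
  · intro h
    refine ⟨hU, h.aemeasurable_limit, ?_⟩
    refine h.tendsto.congr fun i => ?_
    exact Subtype.ext (key i)
  · intro h
    refine ⟨fun i => (hU i).comp_quasiMeasurePreserving (hπ i).quasiMeasurePreserving,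
      h.aemeasurable_limit, ?_⟩
    refine h.tendsto.congr fun i => ?_
    exact Subtype.ext (key i).symm

/-- Slutsky's lemma for random variables defined on varying probability spaces. -/
theorem tendstoInDistribution_of_norm_sub_tendsto {ι E Ω' : Type*} {Ω : ι → Type*}
    [∀ i, MeasurableSpace (Ω i)] {P : ∀ i, Measure (Ω i)} [∀ i, IsProbabilityMeasure (P i)]
    [MeasurableSpace Ω'] {μ' : Measure Ω'} [IsProbabilityMeasure μ']
    [MeasurableSpace E] [NormedAddCommGroup E] [SecondCountableTopology E] [BorelSpace E]
    {U V : ∀ i, Ω i → E} {Z : Ω' → E} {l : Filter ι} [l.IsCountablyGenerated]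
    (hU : TendstoInDistribution U l Z P μ') (hV : ∀ i, AEMeasurable (V i) (P i))
    (hUV : ∀ δ : ℝ, 0 < δ → Tendsto (fun i => P i {ω | δ ≤ ‖V i ω - U i ω‖}) l (𝓝 0)) :
    TendstoInDistribution V l Z P μ' := by
  -- Slutsky's lemma needs a common space: pulling back along the coordinates of the product of all
  -- `P i` changes neither laws nor probabilities of events.
  have hπ : ∀ i, MeasurePreserving (Function.eval i) (Measure.infinitePi P) (P i) :=
    measurePreserving_eval_infinitePi P
  rw [← tendstoInDistribution_comp_measurePreserving hπ hV]
  have hU' := (tendstoInDistribution_comp_measurePreserving hπ hU.forall_aemeasurable).2 hU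
  refine tendstoInDistribution_of_tendstoInMeasure_sub _ _ hU' ?_
    fun i => (hV i).comp_quasiMeasurePreserving (hπ i).quasiMeasurePreserving
  rw [tendstoInMeasure_iff_norm]
  intro δ hδ
  refine (hUV δ hδ).congr fun i => ?_
  have hs : NullMeasurableSet {ω | δ ≤ ‖V i ω - U i ω‖} (P i) :=
    nullMeasurableSet_le aemeasurable_const ((hV i).sub (hU.forall_aemeasurable i)).norm
  rw [← (hπ i).measure_preimage hs]
  simp

/-- A linear image of an isotropic Gaussian vector is Gaussian. -/
theorem hasLaw_mulVec_multivariateGaussian {Ω κ ι : Type*} [MeasurableSpace Ω] {P : Measure Ω}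
    [Fintype κ] [DecidableEq κ] [Fintype ι] [DecidableEq ι] {σ : ℝ}
    {ε : Ω → EuclideanSpace ℝ κ}
    (hε : HasLaw ε (multivariateGaussian 0 (σ ^ 2 • (1 : Matrix κ κ ℝ))) P)
    (B : Matrix ι κ ℝ) :
    HasLaw (fun ω => WithLp.toLp 2 (B *ᵥ (ε ω).ofLp))
      (multivariateGaussian 0 (σ ^ 2 • (B * Bᵀ))) P := by
  have h1 : (σ ^ 2 • (1 : Matrix κ κ ℝ)).PosSemidef :=
    PosSemidef.one.smul (sq_nonneg σ)
  have h2 : (σ ^ 2 • (B * Bᵀ)).PosSemidef := by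
    have := (posSemidef_self_mul_conjTranspose B).smul (sq_nonneg σ)
    simpa using this
  let T : EuclideanSpace ℝ κ →L[ℝ] EuclideanSpace ℝ ι := (toEuclideanLin B).toContinuousLinearMap
  have hT : ∀ x, T x = WithLp.toLp 2 (B *ᵥ x.ofLp) := fun x => rfl
  have hmeas : AEMeasurable (fun ω => T (ε ω)) P :=
    T.continuous.measurable.comp_aemeasurable hε.aemeasurable
  refine ⟨hmeas, ?_⟩
  have hmap : P.map (fun ω => T (ε ω)) = (P.map ε).map T := by
    rw [AEMeasurable.map_map_of_aemeasurable T.continuous.aemeasurable hε.aemeasurable]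
    rfl
  change P.map (fun ω => T (ε ω)) = _
  rw [hmap, hε.map_eq]
  apply Measure.ext_of_charFun
  ext t
  have hadj : ∀ x, inner ℝ (T x) t = inner ℝ x (WithLp.toLp 2 (Bᵀ *ᵥ t.ofLp)) := fun x => by
    rw [hT, EuclideanSpace.inner_eq_star_dotProduct, EuclideanSpace.inner_eq_star_dotProduct]
    simp [dotProduct_mulVec, vecMul_transpose, dotProduct_comm]
  have : charFun ((multivariateGaussian 0 (σ ^ 2 • (1 : Matrix κ κ ℝ))).map T) t =
      charFun (multivariateGaussian 0 (σ ^ 2 • (1 : Matrix κ κ ℝ)))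
        (WithLp.toLp 2 (Bᵀ *ᵥ t.ofLp)) := by
    rw [charFun_apply, charFun_apply, integral_map T.continuous.aemeasurable (by fun_prop)]
    simp_rw [hadj]
  rw [this, charFun_multivariateGaussian h1, charFun_multivariateGaussian h2]
  simp only [inner_zero_right, Complex.ofReal_zero, zero_mul, zero_sub, smul_mulVec, one_mulVec,
    dotProduct_smul]
  congr 5
  rw [← mulVec_mulVec, dotProduct_mulVec t.ofLp B, ← mulVec_transpose]

/-- Centred Gaussian vectors with convergent covariance matrices converge in distribution. -/
theorem tendstoInDistribution_multivariateGaussian {Ω : ℕ → Type*} [∀ n, MeasurableSpace (Ω n)]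
    {P : ∀ n, Measure (Ω n)} [∀ n, IsProbabilityMeasure (P n)] {ι : Type*} [Fintype ι]
    [DecidableEq ι] {C : ℕ → Matrix ι ι ℝ} {C₀ : Matrix ι ι ℝ}
    {U : ∀ n, Ω n → EuclideanSpace ℝ ι}
    (hU : ∀ n, HasLaw (U n) (multivariateGaussian 0 (C n)) (P n))
    (hC : ∀ᶠ n in atTop, (C n).PosSemidef) (hC₀ : C₀.PosSemidef)
    (h : Tendsto C atTop (𝓝 C₀)) :
    TendstoInDistribution U atTop (id : EuclideanSpace ℝ ι → EuclideanSpace ℝ ι) P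
      (multivariateGaussian 0 C₀) := by
  refine ⟨fun n => (hU n).aemeasurable, aemeasurable_id, ?_⟩
  refine ProbabilityMeasure.tendsto_iff_tendsto_charFun.2 fun t => ?_
  simp only [ProbabilityMeasure.coe_mk, Measure.map_id, (hU _).map_eq]
  rw [charFun_multivariateGaussian hC₀]
  have key : Tendsto (fun n => Complex.exp (inner ℝ t 0 * Complex.I -
      (t.ofLp ⬝ᵥ C n *ᵥ t.ofLp : ℝ) / 2)) atTop
      (𝓝 (Complex.exp (inner ℝ t 0 * Complex.I - (t.ofLp ⬝ᵥ C₀ *ᵥ t.ofLp : ℝ) / 2))) := by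
    have hcont : Continuous fun M : Matrix ι ι ℝ => Complex.exp ((inner ℝ t 0 : ℝ) * Complex.I -
      (t.ofLp ⬝ᵥ M *ᵥ t.ofLp : ℝ) / 2) := by fun_prop
    exact (hcont.tendsto C₀).comp h
  refine key.congr' ?_
  filter_upwards [hC] with n hn
  rw [charFun_multivariateGaussian hn]

/-- A sequence converging in distribution is bounded in probability. -/
theorem tendsto_measure_lt_norm_of_tendstoInDistribution {Ω : ℕ → Type*}
    [∀ n, MeasurableSpace (Ω n)]
    {P : ∀ n, Measure (Ω n)} [∀ n, IsProbabilityMeasure (P n)] {E Ω' : Type*}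
    [NormedAddCommGroup E] [InnerProductSpace ℝ E] [FiniteDimensional ℝ E] [MeasurableSpace E]
    [BorelSpace E] [MeasurableSpace Ω'] {μ' : Measure Ω'} [IsProbabilityMeasure μ']
    {U : ∀ n, Ω n → E} {Z : Ω' → E} (h : TendstoInDistribution U atTop Z P μ') {r : ℕ → ℝ}
    (hr : Tendsto r atTop atTop) :
    Tendsto (fun n => P n {ω | r n < ‖U n ω‖}) atTop (𝓝 0) := by
  have hU := h.forall_aemeasurable
  have := h.aemeasurable_limit
  have hp : ∀ n, IsProbabilityMeasure ((P n).map (U n)) :=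
    fun n => Measure.isProbabilityMeasure_map (hU n)
  have : IsProbabilityMeasure (μ'.map Z) := Measure.isProbabilityMeasure_map h.aemeasurable_limit
  -- Pointwise convergence of characteristic functions to a function continuous at 0 forces
  -- tightness, so tails vanish uniformly over the family.
  have ht := isTightMeasureSet_of_tendsto_charFun (μ := fun n => (P n).map (U n))
    (f := charFun (μ'.map Z)) (by fun_prop)
    (ProbabilityMeasure.tendsto_iff_tendsto_charFun.1 h.tendsto)
  rw [isTightMeasureSet_iff_tendsto_measure_norm_gt] at ht
  refine tendsto_of_tendsto_of_tendsto_of_le_of_le tendsto_const_nhds (ht.comp hr)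
    (fun _ => zero_le) fun n => ?_
  have hs : MeasurableSet {x : E | r n < ‖x‖} := measurableSet_lt measurable_const measurable_norm
  calc P n {ω | r n < ‖U n ω‖} = (P n).map (U n) {x | r n < ‖x‖} := by
        rw [Measure.map_apply_of_aemeasurable (hU n) hs]; rfl
    _ ≤ _ := le_iSup₂ (f := fun (μ : Measure E) (_ : μ ∈ Set.range fun n => (P n).map (U n)) =>
        μ {x | r n < ‖x‖}) _ ⟨n, rfl⟩

/-! ### Operator norms and block matrices -/

section
open scoped Matrix.Norms.L2Operator

theorem norm_toLp_mulVec_le {ι κ : Type*} [Fintype ι] [Fintype κ] [DecidableEq κ]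
    (A : Matrix ι κ ℝ) (x : κ → ℝ) :
    ‖WithLp.toLp 2 (A *ᵥ x)‖ ≤ ‖A‖ * ‖WithLp.toLp 2 x‖ :=
  l2_opNorm_mulVec A (WithLp.toLp 2 x)

/-- Unitary diagonalisation preserves the operator norm, and nonnegative eigenvalues need no
absolute values. -/
theorem l2_opNorm_le_maxEigenvalue {ι : Type*} [Fintype ι] [DecidableEq ι] {A : Matrix ι ι ℝ}
    (hA : A.PosSemidef) : ‖A‖ ≤ maxEigenvalue A := by
  have hH := hA.isHermitian
  have hnorm : ‖A‖ = ‖hH.eigenvalues‖ := by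
    conv_lhs => rw [hH.spectral_theorem, Unitary.conjStarAlgAut_apply]
    rw [← Unitary.coe_star, CStarRing.norm_mul_coe_unitary, CStarRing.norm_coe_unitary_mul,
      l2_opNorm_diagonal]
    rfl
  rw [hnorm]
  have hset : {μ : ℝ | Module.End.HasEigenvalue (Matrix.toLin' A) μ} = spectrum ℝ A := by
    ext μ
    rw [Set.mem_ofPred_eq, Module.End.hasEigenvalue_iff_mem_spectrum, spectrum_toLin']
  have hbdd : BddAbove {μ : ℝ | Module.End.HasEigenvalue (Matrix.toLin' A) μ} := by
    rw [hset]; exact (finite_real_spectrum (A := A)).bddAbove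
  have hle : ∀ i, hH.eigenvalues i ≤ maxEigenvalue A := fun i =>
    le_csSup hbdd (by rw [hset]; exact hH.eigenvalues_mem_spectrum_real i)
  rw [pi_norm_le_iff_of_nonneg]
  · intro i
    simpa [abs_of_nonneg (hA.eigenvalues_nonneg i)] using hle i
  -- This also covers the empty index type, where `sSup ∅ = 0` matches the convention `η = 0` for
  -- `p₁ = 0`.
  · refine Real.sSup_nonneg fun μ hμ => ?_
    rw [hset, hH.spectrum_real_eq_range_eigenvalues] at hμ
    obtain ⟨i, rfl⟩ := hμ
    exact hA.eigenvalues_nonneg i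

theorem tendsto_matrix_inv {α ι : Type*} [Fintype ι] [DecidableEq ι] {l : Filter α}
    {M : α → Matrix ι ι ℝ} {M₀ : Matrix ι ι ℝ} (h : Tendsto M l (𝓝 M₀)) (h₀ : M₀.det ≠ 0) :
    Tendsto (fun a => (M a)⁻¹) l (𝓝 M₀⁻¹) := by
  simp only [inv_def, Ring.inverse_eq_inv']
  exact (((continuous_id.matrix_det.tendsto M₀).comp h).inv₀ h₀).smul
    ((continuous_id.matrix_adjugate.tendsto M₀).comp h)

theorem eventually_norm_le_norm_add_one {α E : Type*} [NormedAddCommGroup E] {l : Filter α}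
    {f : α → E} {x : E} (h : Tendsto f l (𝓝 x)) : ∀ᶠ a in l, ‖f a‖ ≤ ‖x‖ + 1 :=
  (h.norm.eventually_lt_const (lt_add_one _)).mono fun _ => le_of_lt

/-- The off-diagonal block of `DᵀD` is controlled by its diagonal blocks. -/
theorem norm_toBlocks₁₂_sq_le {κ ι₁ ι₂ : Type*} [Fintype κ] [Fintype ι₁] [Fintype ι₂]
    [DecidableEq κ] [DecidableEq ι₁] [DecidableEq ι₂] (D : Matrix κ (ι₁ ⊕ ι₂) ℝ) :
    ‖(Dᵀ * D).toBlocks₁₂‖ ^ 2 ≤ ‖(Dᵀ * D).toBlocks₁₁‖ * ‖(Dᵀ * D).toBlocks₂₂‖ := by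
  -- The blocks of `DᵀD` are products of the column blocks of `D`; the C*-identity turns `‖E‖²` into
  -- `‖EᵀE‖`.
  have h : ∀ E : Matrix κ ι₁ ℝ, ∀ F : Matrix κ ι₂ ℝ,
      ‖Eᵀ * F‖ ^ 2 ≤ ‖Eᵀ * E‖ * ‖Fᵀ * F‖ := fun E F => by
    have h1 := l2_opNorm_conjTranspose_mul_self E
    have h2 := l2_opNorm_conjTranspose_mul_self F
    have h3 := l2_opNorm_mul Eᴴ F
    rw [l2_opNorm_conjTranspose] at h3
    simp only [conjTranspose_eq_transpose_of_trivial] at h1 h2 h3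
    rw [h1, h2]
    calc ‖Eᵀ * F‖ ^ 2 ≤ (‖E‖ * ‖F‖) ^ 2 := by gcongr
      _ = _ := by ring
  exact h D.toCols₁ D.toCols₂

end

/-! ### Dead zone and linear zone of the thresholding rules -/

theorem scadUpdate_of_abs_le {a L d u : ℝ} (hL : 0 ≤ L) (hd : 1 ≤ d) (hu : |u| ≤ L) :
    scadUpdate a L d u = 0 := by
  rw [scadUpdate, if_pos (by nlinarith), max_eq_right (by linarith)]
  simp

theorem scadUpdate_of_lt_abs {a L d u : ℝ} (ha : 2 < a) (hL : 0 ≤ L) (hd : 1 ≤ d)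
    (hu : a * L * d < |u|) : scadUpdate a L d u = u / d := by
  -- From `d + 1 ≤ 2d ≤ ad`: the linear zone lies beyond the soft-thresholding zone.
  have h : (d + 1) * L ≤ a * L * d := by nlinarith [mul_nonneg hL (by linarith : 0 ≤ d)]
  rw [scadUpdate, if_neg (by linarith), if_neg (by linarith)]

theorem mcpUpdate_of_abs_le {a L d u : ℝ} (ha : 1 < a) (hL : 0 ≤ L) (hd : 1 ≤ d) (hu : |u| ≤ L) :
    mcpUpdate a L d u = 0 := by
  have h : L ≤ a * L * d := by nlinarith [mul_nonneg hL (by linarith : 0 ≤ d)]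
  rw [mcpUpdate, if_pos (by linarith), max_eq_right (by linarith)]
  simp

theorem mcpUpdate_of_lt_abs {a L d u : ℝ} (hu : a * L * d < |u|) : mcpUpdate a L d u = u / d := by
  rw [mcpUpdate, if_neg (by linarith)]

theorem measurable_real_sign : Measurable Real.sign := by
  unfold Real.sign
  exact Measurable.ite measurableSet_Iio measurable_const
    (Measurable.ite measurableSet_Ioi measurable_const measurable_const)

theorem measurable_scadUpdate (a L d : ℝ) : Measurable (scadUpdate a L d) := by
  have := measurable_real_sign
  unfold scadUpdate
  refine Measurable.ite (measurableSet_le (by fun_prop) (by fun_prop)) (by fun_prop)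
    (Measurable.ite (measurableSet_le (by fun_prop) (by fun_prop)) (by fun_prop) (by fun_prop))

theorem measurable_mcpUpdate (a L d : ℝ) : Measurable (mcpUpdate a L d) := by
  have := measurable_real_sign
  unfold mcpUpdate
  exact Measurable.ite (measurableSet_le (by fun_prop) (by fun_prop)) (by fun_prop) (by fun_prop)

theorem measurable_oemSeq {n m : ℕ} {ι : Type*} [Fintype ι] [DecidableEq ι] {s : ℝ → ℝ}
    (hs : Measurable s) (X : Matrix (Fin n) ι ℝ) (Δ : Matrix (Fin m) ι ℝ) (k : ℕ) :
    Measurable fun Y => oemSeq s X Δ Y k := by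
  induction k with
  | zero =>
    have : Continuous fun Y => ols X Y := by unfold ols; fun_prop
    exact this.measurable
  | succ k ih =>
    have h : Continuous fun q : (Fin n → ℝ) × (ι → ℝ) => oemVec X Δ q.1 q.2 := by
      unfold oemVec; fun_prop
    refine measurable_pi_lambda _ fun j => hs.comp ?_
    exact (measurable_pi_apply j).comp (h.measurable.comp (measurable_id.prodMk ih))

theorem norm_toLp_comp_inl_le {ι₁ ι₂ : Type*} [Fintype ι₁] [Fintype ι₂] (x : ι₁ ⊕ ι₂ → ℝ) :
    ‖WithLp.toLp 2 (x ∘ Sum.inl)‖ ≤ ‖WithLp.toLp 2 x‖ := by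
  rw [EuclideanSpace.norm_eq, EuclideanSpace.norm_eq]
  refine Real.sqrt_le_sqrt ?_
  simp only [Fintype.sum_sum_type, Function.comp_apply]
  exact le_add_of_nonneg_right (Finset.sum_nonneg fun _ _ => sq_nonneg _)

theorem norm_toLp_comp_inr_le {ι₁ ι₂ : Type*} [Fintype ι₁] [Fintype ι₂] (x : ι₁ ⊕ ι₂ → ℝ) :
    ‖WithLp.toLp 2 (x ∘ Sum.inr)‖ ≤ ‖WithLp.toLp 2 x‖ := by
  rw [EuclideanSpace.norm_eq, EuclideanSpace.norm_eq]
  refine Real.sqrt_le_sqrt ?_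
  simp only [Fintype.sum_sum_type, Function.comp_apply]
  exact le_add_of_nonneg_left (Finset.sum_nonneg fun _ _ => sq_nonneg _)

theorem abs_le_norm_toLp {ι : Type*} [Fintype ι] (x : ι → ℝ) (j : ι) :
    |x j| ≤ ‖WithLp.toLp 2 x‖ :=
  PiLp.norm_apply_le (WithLp.toLp 2 x) j

/-! ### The OEM iteration for a fixed error vector -/

/-- The scaled score vector `X'ε / n`. -/
noncomputable def scaledScore {n : ℕ} {ι : Type*} (X : Matrix (Fin n) ι ℝ) (e : Fin n → ℝ) : ι → ℝ :=
  (n : ℝ)⁻¹ • (Xᵀ *ᵥ e)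

section OneStep

variable {n m : ℕ} {ι : Type*} [Fintype ι]
  {X : Matrix (Fin n) ι ℝ} {Δ : Matrix (Fin m) ι ℝ} {d : ℝ}

theorem smul_transpose_mulVec_linearModel (X : Matrix (Fin n) ι ℝ) (β : ι → ℝ) (e : Fin n → ℝ) :
    (n : ℝ)⁻¹ • (Xᵀ *ᵥ (X *ᵥ β + e)) = normGram X *ᵥ β + scaledScore X e := by
  simp [normGram, scaledScore, mulVec_add, smul_mulVec, mulVec_mulVec]

/-- Eliminating `Δ` exhibits a gradient step from `b`, whose gradient term vanishes at the OLS
estimator. -/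
theorem oemVec_linearModel [DecidableEq ι] (hΔ : normGram X + Δᵀ * Δ = d • (1 : Matrix ι ι ℝ))
    (β b : ι → ℝ) (e : Fin n → ℝ) :
    oemVec X Δ (X *ᵥ β + e) b = d • b + (scaledScore X e - normGram X *ᵥ (b - β)) := by
  have h : Δᵀ * Δ = d • (1 : Matrix ι ι ℝ) - normGram X := eq_sub_of_add_eq' hΔ
  rw [oemVec, smul_transpose_mulVec_linearModel, h, sub_mulVec, smul_mulVec, one_mulVec, mulVec_sub]
  abel

theorem ols_linearModel [DecidableEq ι] (hn : n ≠ 0) (hG : (normGram X).det ≠ 0) (β : ι → ℝ) (e : Fin n → ℝ) :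
    ols X (X *ᵥ β + e) = β + (normGram X)⁻¹ *ᵥ scaledScore X e := by
  have hn' : (n : ℝ) ≠ 0 := Nat.cast_ne_zero.2 hn
  have hXX : Xᵀ * X = (n : ℝ) • normGram X := by rw [normGram, smul_inv_smul₀ hn']
  have hY : Xᵀ *ᵥ (X *ᵥ β + e) = (n : ℝ) • (normGram X *ᵥ β + scaledScore X e) := by
    rw [← smul_transpose_mulVec_linearModel, smul_inv_smul₀ hn']
  have hu : IsUnit (normGram X).det := hG.isUnit
  have : Invertible (n : ℝ) := invertibleOfNonzero hn'
  rw [ols, hY, hXX, inv_smul _ _ hu, mulVec_smul, smul_mulVec, invOf_eq_inv,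
    smul_inv_smul₀ hn', mulVec_add, mulVec_mulVec, nonsing_inv_mul _ hu, one_mulVec]

end OneStep

section
open scoped Matrix.Norms.L2Operator

variable {p₁ p₂ n m : ℕ} {X : Matrix (Fin n) (Fin p₁ ⊕ Fin p₂) ℝ}
  {Δ : Matrix (Fin m) (Fin p₁ ⊕ Fin p₂) ℝ} {d : ℝ}

/-- As long as the score vector is small compared with the threshold `L`, every OEM iterate
annihilates the second block and follows the linear recursion of the oracle in the first. -/
theorem oemSeq_succ_eq {s : ℝ → ℝ} {a L D K N ρ : ℝ}
    (hs₁ : ∀ u, |u| ≤ L → s u = 0) (hs₂ : ∀ u, a * L * d < |u| → s u = u / d)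
    (hn : n ≠ 0) (hd : 1 ≤ d) (hdD : d ≤ D)
    (hΔ : normGram X + Δᵀ * Δ = d • (1 : Matrix (Fin p₁ ⊕ Fin p₂) (Fin p₁ ⊕ Fin p₂) ℝ))
    (hG : (normGram X).det ≠ 0) (hG₁ : (normGram X).toBlocks₁₁.det ≠ 0)
    (hK : ‖(normGram X)⁻¹‖ ≤ K) (hK₁ : ‖(normGram X).toBlocks₁₁⁻¹‖ ≤ K)
    (hN : ‖(normGram X).toBlocks₂₁‖ ≤ N)
    (hA : ‖(1 : Matrix (Fin p₁) (Fin p₁) ℝ) - d⁻¹ • (normGram X).toBlocks₁₁‖ ≤ 1)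
    {β : Fin p₁ ⊕ Fin p₂ → ℝ} (hβ₂ : ∀ j, β (Sum.inr j) = 0) {e : Fin n → ℝ}
    (hρ : ‖WithLp.toLp 2 (scaledScore X e)‖ ≤ ρ)
    (h₀ : D * (K * ρ) ≤ L) (h₂ : ρ + N * (3 * (K * ρ)) ≤ L)
    (h₁ : ∀ j, 3 * (K * ρ) + a * L < |β (Sum.inl j)|) (k : ℕ) :
    oemSeq s X Δ (X *ᵥ β + e) (k + 1) = β + Sum.elim
      ((normGram X).toBlocks₁₁⁻¹ *ᵥ (scaledScore X e ∘ Sum.inl) +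
        ((1 : Matrix (Fin p₁) (Fin p₁) ℝ) - d⁻¹ • (normGram X).toBlocks₁₁) ^ k *ᵥ
          (((normGram X)⁻¹ *ᵥ scaledScore X e) ∘ Sum.inl -
            (normGram X).toBlocks₁₁⁻¹ *ᵥ (scaledScore X e ∘ Sum.inl))) 0 := by
  set G := normGram X with hGdef
  set w := scaledScore X e with hw
  set A := (1 : Matrix (Fin p₁) (Fin p₁) ℝ) - d⁻¹ • G.toBlocks₁₁ with hAdef
  set e₀ := G⁻¹ *ᵥ w with he₀
  set z := G.toBlocks₁₁⁻¹ *ᵥ (w ∘ Sum.inl) with hz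
  have hd0 : 0 < d := by linarith
  have hK0 : 0 ≤ K := (norm_nonneg _).trans hK
  have hN0 : 0 ≤ N := (norm_nonneg _).trans hN
  have hρ0 : 0 ≤ ρ := (norm_nonneg _).trans hρ
  have hKρ : 0 ≤ K * ρ := mul_nonneg hK0 hρ0
  have he₀K : ‖WithLp.toLp 2 e₀‖ ≤ K * ρ :=
    (norm_toLp_mulVec_le _ _).trans (mul_le_mul hK hρ (norm_nonneg _) hK0)
  have hzK : ‖WithLp.toLp 2 z‖ ≤ K * ρ :=
    (norm_toLp_mulVec_le _ _).trans
      (mul_le_mul hK₁ ((norm_toLp_comp_inl_le _).trans hρ) (norm_nonneg _) hK0)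
  have hdiff : ‖WithLp.toLp 2 (e₀ ∘ Sum.inl - z)‖ ≤ 2 * (K * ρ) := by
    rw [WithLp.toLp_sub]
    have := norm_sub_le (WithLp.toLp 2 (e₀ ∘ Sum.inl)) (WithLp.toLp 2 z)
    have := norm_toLp_comp_inl_le e₀
    linarith
  have hpow : ∀ i, ‖WithLp.toLp 2 (A ^ i *ᵥ (e₀ ∘ Sum.inl - z))‖ ≤ 2 * (K * ρ) := by
    intro i
    induction i with
    | zero => simpa using hdiff
    | succ i ih =>
      rw [pow_succ', ← mulVec_mulVec]
      refine (norm_toLp_mulVec_le _ _).trans (le_trans ?_ ih)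
      exact mul_le_of_le_one_left (norm_nonneg _) hA
  -- Candidate first-block error. The factor 3 below is 1 from `z` plus 2 from the deviation, which
  -- `A` does not enlarge.
  set r : ℕ → Fin p₁ → ℝ := fun i => z + A ^ i *ᵥ (e₀ ∘ Sum.inl - z) with hr
  have hrK : ∀ i, ‖WithLp.toLp 2 (r i)‖ ≤ 3 * (K * ρ) := fun i => by
    have := norm_add_le (WithLp.toLp 2 z) (WithLp.toLp 2 (A ^ i *ᵥ (e₀ ∘ Sum.inl - z)))
    have := hpow i
    simp only [hr, WithLp.toLp_add]
    linarith
  have hbig : ∀ j, ∀ t : ℝ, |t| ≤ 3 * (K * ρ) → s (d * (β (Sum.inl j) + t)) =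
      β (Sum.inl j) + t := fun j t ht => by
    have h3 : a * L < |β (Sum.inl j) + t| := by
      have := abs_sub_abs_le_abs_sub (β (Sum.inl j)) (-t)
      rw [abs_neg, sub_neg_eq_add] at this
      have := h₁ j
      linarith
    rw [hs₂, mul_div_cancel_left₀ _ hd0.ne']
    rw [abs_mul, abs_of_pos hd0, mul_comm]
    exact mul_lt_mul_of_pos_left h3 hd0
  have hGz : G.toBlocks₁₁ *ᵥ z = w ∘ Sum.inl := by
    rw [hz, mulVec_mulVec, mul_nonsing_inv _ hG₁.isUnit, one_mulVec]
  induction k with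
  | zero =>
    -- At OLS the gradient term is zero, so iterate 1 keeps the first OLS block: the power of `A`
    -- lags one behind the iteration count.
    have hu : oemVec X Δ (X *ᵥ β + e) (oemSeq s X Δ (X *ᵥ β + e) 0) = d • (β + e₀) := by
      rw [oemVec_linearModel hΔ, oemSeq, ols_linearModel hn hG, add_sub_cancel_left, mulVec_mulVec,
        mul_nonsing_inv _ hG.isUnit, one_mulVec, sub_self, add_zero]
    ext j
    rw [oemSeq, hu]
    rcases j with j | j
    · simp only [Pi.smul_apply, Pi.add_apply, smul_eq_mul, pow_zero, one_mulVec,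
        add_sub_cancel, Sum.elim_inl, Function.comp_apply]
      refine hbig j _ ?_
      have := abs_le_norm_toLp e₀ (Sum.inl j)
      linarith
    · simp only [Pi.smul_apply, Pi.add_apply, smul_eq_mul, Sum.elim_inr, hβ₂, zero_add,
        Pi.zero_apply]
      refine hs₁ _ (le_trans ?_ h₀)
      rw [abs_mul, abs_of_pos hd0]
      exact mul_le_mul hdD ((abs_le_norm_toLp e₀ _).trans he₀K) (abs_nonneg _) (by linarith)
  | succ k ih =>
    have hu : oemVec X Δ (X *ᵥ β + e) (oemSeq s X Δ (X *ᵥ β + e) (k + 1)) =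
        d • (β + Sum.elim (r k) 0) + (w - G *ᵥ Sum.elim (r k) 0) := by
      rw [oemVec_linearModel hΔ, ih, add_sub_cancel_left]
    have hGr : G *ᵥ Sum.elim (r k) (0 : Fin p₂ → ℝ) =
        Sum.elim (G.toBlocks₁₁ *ᵥ r k) (G.toBlocks₂₁ *ᵥ r k) := by
      conv_lhs => rw [← fromBlocks_toBlocks G, fromBlocks_mulVec]
      simp
    -- By `hGz`, `z` is the fixed point of this affine map, and `A` is its linear part.
    have hstep : r (k + 1) = r k + d⁻¹ • (w ∘ Sum.inl - G.toBlocks₁₁ *ᵥ r k) := by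
      have h1 : w ∘ Sum.inl - G.toBlocks₁₁ *ᵥ r k =
          -(G.toBlocks₁₁ *ᵥ (A ^ k *ᵥ (e₀ ∘ Sum.inl - z))) := by
        simp only [hr, mulVec_add, hGz]
        abel
      rw [h1]
      simp only [hr]
      rw [pow_succ', ← mulVec_mulVec]
      nth_rewrite 1 [hAdef]
      rw [sub_mulVec, one_mulVec, smul_mulVec, smul_neg]
      abel
    rw [oemSeq, hu, hGr]
    ext j
    rcases j with j | j
    · have h2 := congrFun hstep j
      simp only [Pi.add_apply, Pi.smul_apply, Pi.sub_apply, smul_eq_mul,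
        Function.comp_apply] at h2
      have h3 : (d • (β + Sum.elim (r k) (0 : Fin p₂ → ℝ)) + (w - Sum.elim (G.toBlocks₁₁ *ᵥ r k)
          (G.toBlocks₂₁ *ᵥ r k))) (Sum.inl j) = d * (β (Sum.inl j) + r (k + 1) j) := by
        rw [h2]
        simp only [Pi.add_apply, Pi.smul_apply, Pi.sub_apply, smul_eq_mul, Sum.elim_inl]
        field_simp
        ring
      change s _ = β (Sum.inl j) + r (k + 1) j
      rw [h3]
      exact hbig j _ ((abs_le_norm_toLp _ j).trans (hrK _))
    · simp only [Pi.add_apply, Pi.smul_apply, Pi.sub_apply, smul_eq_mul, Sum.elim_inr, hβ₂,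
        Pi.zero_apply, add_zero, mul_zero, zero_add]
      refine hs₁ _ (le_trans ?_ h₂)
      refine (abs_sub _ _).trans (add_le_add ((abs_le_norm_toLp w _).trans hρ) ?_)
      refine (abs_le_norm_toLp (G.toBlocks₂₁ *ᵥ r k) j).trans ((norm_toLp_mulVec_le _ _).trans ?_)
      exact mul_le_mul hN (hrK k) (norm_nonneg _) hN0

/-- The first block of the least squares error differs from the error of the oracle by an amount
that is controlled by the contraction factor of the oracle recursion. -/
theorem norm_ols_sub_oracle_le {D K N η : ℝ} (hd : 1 ≤ d) (hdD : d ≤ D)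
    (hΔ : normGram X + Δᵀ * Δ = d • (1 : Matrix (Fin p₁ ⊕ Fin p₂) (Fin p₁ ⊕ Fin p₂) ℝ))
    (hG : (normGram X).det ≠ 0) (hG₁ : (normGram X).toBlocks₁₁.det ≠ 0)
    (hK : ‖(normGram X)⁻¹‖ ≤ K) (hK₁ : ‖(normGram X).toBlocks₁₁⁻¹‖ ≤ K)
    (hN : ‖(Δᵀ * Δ).toBlocks₂₂‖ ≤ N)
    (hA : ‖(1 : Matrix (Fin p₁) (Fin p₁) ℝ) - d⁻¹ • (normGram X).toBlocks₁₁‖ ≤ η)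
    (w : Fin p₁ ⊕ Fin p₂ → ℝ) :
    ‖WithLp.toLp 2 (((normGram X)⁻¹ *ᵥ w) ∘ Sum.inl -
        (normGram X).toBlocks₁₁⁻¹ *ᵥ (w ∘ Sum.inl))‖ ≤
      K ^ 2 * √(D * N) * √η * ‖WithLp.toLp 2 w‖ := by
  set G := normGram X with hGdef
  set e₀ := G⁻¹ *ᵥ w with he₀
  have hd0 : 0 < d := by linarith
  have hK0 : 0 ≤ K := (norm_nonneg _).trans hK
  have hη0 : 0 ≤ η := (norm_nonneg _).trans hA
  have hGe : G *ᵥ e₀ = w := by rw [he₀, mulVec_mulVec, mul_nonsing_inv _ hG.isUnit, one_mulVec]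
  have hblock : G.toBlocks₁₁ *ᵥ (e₀ ∘ Sum.inl) + G.toBlocks₁₂ *ᵥ (e₀ ∘ Sum.inr) =
      w ∘ Sum.inl := by
    rw [← hGe]
    conv_rhs => rw [← fromBlocks_toBlocks G, fromBlocks_mulVec]
    rfl
  -- Block elimination in the first row of `G e₀ = w`.
  have hdiff : e₀ ∘ Sum.inl - G.toBlocks₁₁⁻¹ *ᵥ (w ∘ Sum.inl) =
      -(G.toBlocks₁₁⁻¹ *ᵥ (G.toBlocks₁₂ *ᵥ (e₀ ∘ Sum.inr))) := by
    rw [← hblock, mulVec_add, mulVec_mulVec, nonsing_inv_mul _ hG₁.isUnit, one_mulVec]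
    abel
  have hΔG : Δᵀ * Δ = d • (1 : Matrix (Fin p₁ ⊕ Fin p₂) (Fin p₁ ⊕ Fin p₂) ℝ) - G :=
    eq_sub_of_add_eq' hΔ
  have h12 : (Δᵀ * Δ).toBlocks₁₂ = -G.toBlocks₁₂ := by
    rw [hΔG]
    ext i j
    simp [toBlocks₁₂, one_apply]
  have h11 : (Δᵀ * Δ).toBlocks₁₁ =
      d • ((1 : Matrix (Fin p₁) (Fin p₁) ℝ) - d⁻¹ • G.toBlocks₁₁) := by
    rw [hΔG, smul_sub, smul_inv_smul₀ hd0.ne']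
    ext i j
    simp [toBlocks₁₁, one_apply]
  -- The (1,1) block of `Δ'Δ` is `d A`, of norm at most `D η`; its off-diagonal block is `-G₁₂`.
  have hG12 : ‖G.toBlocks₁₂‖ ≤ √(D * N) * √η := by
    have h := norm_toBlocks₁₂_sq_le Δ
    rw [h12, norm_neg, h11, norm_smul, Real.norm_of_nonneg hd0.le] at h
    have hN0 : 0 ≤ N := (norm_nonneg _).trans hN
    rw [← Real.sqrt_mul (mul_nonneg (by linarith) hN0)]
    refine Real.le_sqrt_of_sq_le (h.trans ?_)
    have hD0 : 0 ≤ D := by linarith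
    calc _ ≤ D * η * N := by gcongr
      _ = _ := by ring
  rw [hdiff, WithLp.toLp_neg, norm_neg]
  calc _ ≤ ‖G.toBlocks₁₁⁻¹‖ * ‖WithLp.toLp 2 (G.toBlocks₁₂ *ᵥ (e₀ ∘ Sum.inr))‖ :=
        norm_toLp_mulVec_le _ _
    _ ≤ K * (‖G.toBlocks₁₂‖ * ‖WithLp.toLp 2 (e₀ ∘ Sum.inr)‖) := by
        gcongr
        exact norm_toLp_mulVec_le _ _
    _ ≤ K * ((√(D * N) * √η) * (K * ‖WithLp.toLp 2 w‖)) := by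
        gcongr
        refine (norm_toLp_comp_inr_le _).trans ((norm_toLp_mulVec_le _ _).trans ?_)
        gcongr
    _ = _ := by ring

theorem norm_toLp_pow_mulVec_le {ι : Type*} [Fintype ι] [DecidableEq ι] {A : Matrix ι ι ℝ} {η : ℝ}
    (hA : ‖A‖ ≤ η) (k : ℕ) (x : ι → ℝ) :
    ‖WithLp.toLp 2 (A ^ k *ᵥ x)‖ ≤ η ^ k * ‖WithLp.toLp 2 x‖ := by
  have hη : 0 ≤ η := (norm_nonneg _).trans hA
  induction k with
  | zero => simp
  | succ k ih =>
    rw [pow_succ', ← mulVec_mulVec, pow_succ', mul_assoc]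
    exact (norm_toLp_mulVec_le _ _).trans (mul_le_mul hA ih (norm_nonneg _) hη)

end

/-! ### Gaussian limits of the score and of the oracle estimator -/

theorem sqrt_smul_inv_smul {E : Type*} [AddCommGroup E] [Module ℝ E] (n : ℕ) (x : E) :
    √(n : ℝ) • (n : ℝ)⁻¹ • x = (√(n : ℝ))⁻¹ • x := by
  rw [smul_smul, ← div_eq_mul_inv, Real.sqrt_div_self', one_div]

theorem inv_sqrt_smul_mul_transpose {n : ℕ} {κ ι : Type*} [Fintype κ] (B : Matrix ι κ ℝ) :
    ((√(n : ℝ))⁻¹ • B) * ((√(n : ℝ))⁻¹ • B)ᵀ = (n : ℝ)⁻¹ • (B * Bᵀ) := by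
  rw [transpose_smul, smul_mul, Matrix.mul_smul, smul_smul, ← mul_inv,
    Real.mul_self_sqrt (Nat.cast_nonneg n)]

theorem posSemidef_normGram {n : ℕ} {ι : Type*} [Fintype ι] (X : Matrix (Fin n) ι ℝ) :
    (normGram X).PosSemidef := by
  have := (posSemidef_conjTranspose_mul_self X).smul (inv_nonneg.2 (Nat.cast_nonneg (α := ℝ) n))
  simpa [normGram] using this

theorem posDef_toBlocks₁₁ {ι₁ ι₂ : Type*} [Fintype ι₁] [Fintype ι₂]
    {S : Matrix (ι₁ ⊕ ι₂) (ι₁ ⊕ ι₂) ℝ} (hS : S.PosDef) : S.toBlocks₁₁.PosDef :=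
  hS.submatrix Sum.inl_injective

theorem tendsto_toBlocks₁₁ {α ι₁ ι₂ : Type*} {l : Filter α}
    {M : α → Matrix (ι₁ ⊕ ι₂) (ι₁ ⊕ ι₂) ℝ} {S : Matrix (ι₁ ⊕ ι₂) (ι₁ ⊕ ι₂) ℝ}
    (h : Tendsto M l (𝓝 S)) : Tendsto (fun a => (M a).toBlocks₁₁) l (𝓝 S.toBlocks₁₁) := by
  have : Continuous fun A : Matrix (ι₁ ⊕ ι₂) (ι₁ ⊕ ι₂) ℝ => A.toBlocks₁₁ :=
    continuous_id.matrix_submatrix _ _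
  exact (this.tendsto S).comp h

theorem eventually_det_ne_zero {α ι : Type*} [Fintype ι] [DecidableEq ι] {l : Filter α}
    {M : α → Matrix ι ι ℝ} {M₀ : Matrix ι ι ℝ} (h : Tendsto M l (𝓝 M₀)) (h₀ : M₀.det ≠ 0) :
    ∀ᶠ a in l, (M a).det ≠ 0 :=
  ((continuous_id.matrix_det.tendsto M₀).comp h).eventually_ne h₀

section Probability

variable {p₁ p₂ : ℕ} {Ω : ℕ → Type*} [∀ n, MeasurableSpace (Ω n)]
  {P : ∀ n, Measure (Ω n)} [∀ n, IsProbabilityMeasure (P n)] {σ : ℝ}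
  {ε : ∀ n, Ω n → EuclideanSpace ℝ (Fin n)}
  {X : ∀ n, Matrix (Fin n) (Fin p₁ ⊕ Fin p₂) ℝ}
  {S : Matrix (Fin p₁ ⊕ Fin p₂) (Fin p₁ ⊕ Fin p₂) ℝ}

/-- The normalized score vector is asymptotically normal. -/
theorem tendstoInDistribution_score
    (hε : ∀ n, HasLaw (ε n)
      (multivariateGaussian 0 (σ ^ 2 • (1 : Matrix (Fin n) (Fin n) ℝ))) (P n))
    (hS : S.PosDef) (hX : Tendsto (fun n => normGram (X n)) atTop (𝓝 S)) :
    TendstoInDistribution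
      (fun (n : ℕ) ω => √(n : ℝ) • WithLp.toLp 2 (scaledScore (X n) (ε n ω).ofLp))
      atTop (id : EuclideanSpace ℝ (Fin p₁ ⊕ Fin p₂) → EuclideanSpace ℝ (Fin p₁ ⊕ Fin p₂)) P
      (multivariateGaussian 0 (σ ^ 2 • S)) := by
  refine tendstoInDistribution_multivariateGaussian (C := fun n => σ ^ 2 • normGram (X n))
    (fun n => ?_) (.of_forall fun n => (posSemidef_normGram _).smul (sq_nonneg σ))
    (hS.posSemidef.smul (sq_nonneg σ)) (hX.const_smul _)
  have h := hasLaw_mulVec_multivariateGaussian (hε n) ((√(n : ℝ))⁻¹ • (X n)ᵀ)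
  rw [inv_sqrt_smul_mul_transpose, transpose_transpose] at h
  simpa only [scaledScore, ← WithLp.toLp_smul, sqrt_smul_inv_smul, ← smul_mulVec, normGram] using h

/-- The oracle least squares estimator is asymptotically normal. -/
theorem tendstoInDistribution_oracle
    (hε : ∀ n, HasLaw (ε n)
      (multivariateGaussian 0 (σ ^ 2 • (1 : Matrix (Fin n) (Fin n) ℝ))) (P n))
    (hS : S.PosDef) (hX : Tendsto (fun n => normGram (X n)) atTop (𝓝 S)) :
    TendstoInDistribution
      (fun (n : ℕ) ω => √(n : ℝ) • WithLp.toLp 2 ((normGram (X n)).toBlocks₁₁⁻¹ *ᵥ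
        (scaledScore (X n) (ε n ω).ofLp ∘ Sum.inl)))
      atTop (id : EuclideanSpace ℝ (Fin p₁) → EuclideanSpace ℝ (Fin p₁)) P
      (multivariateGaussian 0 (σ ^ 2 • (S.toBlocks₁₁)⁻¹)) := by
  have hS₁ := posDef_toBlocks₁₁ hS
  have hX₁ := tendsto_toBlocks₁₁ hX
  have hdet : ∀ᶠ n in atTop, (normGram (X n)).toBlocks₁₁.det ≠ 0 :=
    eventually_det_ne_zero hX₁ hS₁.det_pos.ne'
  -- `√n` times the oracle error is exactly `B n` applied to the noise, and `B Bᵀ = G₁₁⁻¹` once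
  -- `G₁₁` is invertible.
  set B : ∀ n : ℕ, Matrix (Fin p₁) (Fin n) ℝ := fun n =>
    (√(n : ℝ))⁻¹ • ((normGram (X n)).toBlocks₁₁⁻¹ * (X n).toCols₁ᵀ) with hB
  have hpsd : ∀ n, (B n * (B n)ᵀ).PosSemidef := fun n => by
    simpa using posSemidef_self_mul_conjTranspose (B n)
  have hBB : ∀ n, (normGram (X n)).toBlocks₁₁.det ≠ 0 →
      B n * (B n)ᵀ = (normGram (X n)).toBlocks₁₁⁻¹ := fun n hn => by
    have hsymm : (normGram (X n)).toBlocks₁₁⁻¹ᵀ = (normGram (X n)).toBlocks₁₁⁻¹ := by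
      have := (posSemidef_normGram (X n).toCols₁).inv.isHermitian.eq
      rwa [conjTranspose_eq_transpose_of_trivial] at this
    rw [hB]
    simp only [inv_sqrt_smul_mul_transpose, transpose_mul, transpose_transpose, hsymm]
    rw [Matrix.mul_assoc, ← Matrix.mul_assoc (X n).toCols₁ᵀ, ← Matrix.mul_smul, ← Matrix.smul_mul]
    change _ * ((normGram (X n)).toBlocks₁₁ * _) = _
    rw [mul_nonsing_inv _ hn.isUnit, Matrix.mul_one]
  refine tendstoInDistribution_multivariateGaussian (C := fun n => σ ^ 2 • (B n * (B n)ᵀ))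
    (fun n => ?_) (.of_forall fun n => (hpsd n).smul (sq_nonneg σ))
    (hS₁.inv.posSemidef.smul (sq_nonneg σ)) ?_
  · have h := hasLaw_mulVec_multivariateGaussian (hε n) (B n)
    have heq : ∀ ω, √(n : ℝ) • WithLp.toLp 2 ((normGram (X n)).toBlocks₁₁⁻¹ *ᵥ
        (scaledScore (X n) (ε n ω).ofLp ∘ Sum.inl)) = WithLp.toLp 2 (B n *ᵥ (ε n ω).ofLp) := by
      intro ω
      have h1 : scaledScore (X n) (ε n ω).ofLp ∘ Sum.inl =
        (n : ℝ)⁻¹ • ((X n).toCols₁ᵀ *ᵥ (ε n ω).ofLp) := rfl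
      rw [h1, hB, mulVec_smul, ← WithLp.toLp_smul, sqrt_smul_inv_smul, mulVec_mulVec, smul_mulVec]
    simpa only [heq] using h
  · refine Tendsto.const_smul ?_ _
    refine (tendsto_matrix_inv hX₁ hS₁.det_pos.ne').congr' ?_
    filter_upwards [hdet] with n hn
    rw [hBB n hn]

/-- Estimators which, on events where the score is not too large, annihilate the second block and
are close to the oracle least squares estimator in the first block, have the oracle property. -/
theorem oracleProperty_of_eventually
    (hε : ∀ n, HasLaw (ε n)
      (multivariateGaussian 0 (σ ^ 2 • (1 : Matrix (Fin n) (Fin n) ℝ))) (P n))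
    (hS : S.PosDef) (hX : Tendsto (fun n => normGram (X n)) atTop (𝓝 S))
    {β : Fin p₁ ⊕ Fin p₂ → ℝ} {b : ∀ n, Ω n → Fin p₁ ⊕ Fin p₂ → ℝ}
    (hb : ∀ n, AEMeasurable (b n) (P n)) {r δ : ℕ → ℝ} (hr : Tendsto r atTop atTop)
    (hδ : Tendsto δ atTop (𝓝 0))
    (h : ∀ᶠ n : ℕ in atTop, ∀ ω,
      ‖√(n : ℝ) • WithLp.toLp 2 (scaledScore (X n) (ε n ω).ofLp)‖ ≤ r n →
      (∀ j, b n ω (Sum.inr j) = 0) ∧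
      ‖√(n : ℝ) • WithLp.toLp 2 (fun j : Fin p₁ => b n ω (Sum.inl j) - β (Sum.inl j)) -
        √(n : ℝ) • WithLp.toLp 2 ((normGram (X n)).toBlocks₁₁⁻¹ *ᵥ
          (scaledScore (X n) (ε n ω).ofLp ∘ Sum.inl))‖ ≤
      δ n * ‖√(n : ℝ) • WithLp.toLp 2 (scaledScore (X n) (ε n ω).ofLp)‖) :
    OracleProperty P S σ β b := by
  have hW := tendstoInDistribution_score hε hS hX
  constructor
  · have h0 := tendsto_measure_lt_norm_of_tendstoInDistribution hW hr
    have h1 := ENNReal.Tendsto.sub (tendsto_const_nhds (x := (1 : ENNReal))) h0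
      (Or.inl ENNReal.one_ne_top)
    rw [tsub_zero] at h1
    refine tendsto_of_tendsto_of_tendsto_of_le_of_le' h1 tendsto_const_nhds ?_
      (.of_forall fun n => prob_le_one)
    filter_upwards [h] with n hn
    rw [tsub_le_iff_right, ← measure_univ (μ := P n)]
    refine (measure_mono fun ω _ => ?_).trans (measure_union_le _ _)
    by_cases hω : ‖√(n : ℝ) • WithLp.toLp 2 (scaledScore (X n) (ε n ω).ofLp)‖ ≤ r n
    · exact Or.inl (hn ω hω).1
    · exact Or.inr (not_le.1 hω)
  · refine tendstoInDistribution_of_norm_sub_tendsto (tendstoInDistribution_oracle hε hS hX)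
      (fun n => ?_) fun η hη => ?_
    · have hc : Continuous fun x : Fin p₁ ⊕ Fin p₂ → ℝ => √(n : ℝ) • WithLp.toLp 2
          (fun j : Fin p₁ => x (Sum.inl j) - β (Sum.inl j)) := by fun_prop
      exact hc.measurable.comp_aemeasurable (hb n)
    -- A strictly positive majorant of `δ`, so that it can be inverted. A deviation of at least the
    -- tolerance `η` then forces the score norm above `min (r n) (η / (2 t n))`, which tends to
    -- infinity.
    · set t : ℕ → ℝ := fun n => |δ n| + 1 / ((n : ℝ) + 1) with ht
      have htpos : ∀ n, 0 < t n := fun n => by positivity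
      have ht0 : Tendsto t atTop (𝓝[>] 0) := by
        refine tendsto_nhdsWithin_iff.2 ⟨?_, .of_forall htpos⟩
        simpa [ht] using hδ.abs.add tendsto_one_div_add_atTop_nhds_zero_nat
      have hr' : Tendsto (fun n => min (r n) (η / 2 * (t n)⁻¹)) atTop atTop :=
        tendsto_atTop.2 fun c => by
          filter_upwards [hr.eventually_ge_atTop c,
            (ht0.inv_tendsto_nhdsGT_zero.const_mul_atTop (half_pos hη)).eventually_ge_atTop c]
            with n h1 h2 using le_min h1 h2
      refine tendsto_of_tendsto_of_tendsto_of_le_of_le' tendsto_const_nhds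
        (tendsto_measure_lt_norm_of_tendstoInDistribution hW hr') (.of_forall fun _ => zero_le) ?_
      filter_upwards [h] with n hn
      refine measure_mono fun ω (hω : η ≤ _) => ?_
      by_contra hcon
      have hle : ‖√(n : ℝ) • WithLp.toLp 2 (scaledScore (X n) (ε n ω).ofLp)‖ ≤
          min (r n) (η / 2 * (t n)⁻¹) := not_lt.1 fun hlt => hcon hlt
      have h1 := (hn ω (hle.trans (min_le_left _ _))).2
      have h2 := hle.trans (min_le_right _ _)
      have h3 : δ n ≤ t n := (le_abs_self _).trans (le_add_of_nonneg_right (by positivity))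
      have h4 := hω.trans h1
      have h5 : t n * (η / 2 * (t n)⁻¹) = η / 2 := by
        field_simp [(htpos n).ne']
      have h6 : δ n * ‖√(n : ℝ) • WithLp.toLp 2 (scaledScore (X n) (ε n ω).ofLp)‖ ≤
          t n * (η / 2 * (t n)⁻¹) :=
        mul_le_mul h3 h2 (norm_nonneg _) (htpos n).le
      linarith

end Probability

/-! ### Oracle property for general thresholding rules -/

section
open scoped Matrix.Norms.L2Operator

/-- Oracle property of the OEM sequence for any thresholding rule that vanishes on `[-L, L]` and
is a plain rescaling outside `[-aLd, aLd]`. -/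
theorem oracleProperty_oemSeq {p₁ p₂ : ℕ} {Ω : ℕ → Type*} [∀ n, MeasurableSpace (Ω n)]
    {P : ∀ n, Measure (Ω n)} [∀ n, IsProbabilityMeasure (P n)] {σ : ℝ}
    {ε : ∀ n, Ω n → EuclideanSpace ℝ (Fin n)}
    (hε : ∀ n, HasLaw (ε n)
      (multivariateGaussian 0 (σ ^ 2 • (1 : Matrix (Fin n) (Fin n) ℝ))) (P n))
    {β : Fin p₁ ⊕ Fin p₂ → ℝ}
    (hβ₁ : ∀ j, β (Sum.inl j) ≠ 0) (hβ₂ : ∀ j, β (Sum.inr j) = 0)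
    {X : ∀ n, Matrix (Fin n) (Fin p₁ ⊕ Fin p₂) ℝ}
    {S : Matrix (Fin p₁ ⊕ Fin p₂) (Fin p₁ ⊕ Fin p₂) ℝ} (hS : S.PosDef)
    (hX : Tendsto (fun n => normGram (X n)) atTop (𝓝 S))
    (hdiag : ∀ n, 1 ≤ n → ∀ j, normGram (X n) j j = 1)
    {m : ℕ → ℕ} {Δ : ∀ n, Matrix (Fin (m n)) (Fin p₁ ⊕ Fin p₂) ℝ} {d : ℕ → ℝ}
    (hΔ : ∀ n, 1 ≤ n → normGram (X n) + (Δ n)ᵀ * Δ n =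
      d n • (1 : Matrix (Fin p₁ ⊕ Fin p₂) (Fin p₁ ⊕ Fin p₂) ℝ))
    (hd : d =O[atTop] fun _ => (1 : ℝ)) {lam : ℕ → ℝ}
    (hlam₁ : Tendsto (fun n : ℕ => lam n / n) atTop (𝓝 0))
    (hlam₂ : Tendsto (fun n : ℕ => lam n / √(n : ℝ)) atTop atTop) {k : ℕ → ℕ}
    (hk : Tendsto (fun n : ℕ =>
      maxEigenvalue ((1 : Matrix (Fin p₁) (Fin p₁) ℝ) - (d n)⁻¹ • (normGram (X n)).toBlocks₁₁) ^ k n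
        * lam n / √(n : ℝ)) atTop (𝓝 0))
    {s : ℕ → ℝ → ℝ} {a : ℝ} (hs : ∀ n, Measurable (s n))
    (hs₁ : ∀ n, 0 ≤ lam n / n → 1 ≤ d n → ∀ u, |u| ≤ lam n / n → s n u = 0)
    (hs₂ : ∀ n, 0 ≤ lam n / n → 1 ≤ d n → ∀ u, a * (lam n / n) * d n < |u| → s n u = u / d n) :
    OracleProperty P S σ β (fun n ω =>
      oemSeq (s n) (X n) (Δ n) (X n *ᵥ β + (ε n ω).ofLp) (k n)) := by
  have hmeas : ∀ n, AEMeasurable (fun ω =>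
      oemSeq (s n) (X n) (Δ n) (X n *ᵥ β + (ε n ω).ofLp) (k n)) (P n) := fun n => by
    have hc : Continuous fun x : EuclideanSpace ℝ (Fin n) => X n *ᵥ β + x.ofLp := by fun_prop
    exact ((measurable_oemSeq (hs n) (X n) (Δ n) (k n)).comp hc.measurable).comp_aemeasurable
      (hε n).aemeasurable
  -- The bound `1 ≤ d` is read off a diagonal entry of `G + Δ'Δ = d I`, so at least one coordinate
  -- is needed.
  rcases isEmpty_or_nonempty (Fin p₁ ⊕ Fin p₂) with hp | ⟨⟨j₀⟩⟩
  · have : IsEmpty (Fin p₁) := ⟨fun j => hp.elim (Sum.inl j)⟩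
    refine oracleProperty_of_eventually hε hS hX hmeas tendsto_natCast_atTop_atTop
      tendsto_const_nhds (.of_forall fun n ω _ => ⟨fun j => hp.elim (Sum.inr j), ?_⟩)
    rw [Subsingleton.elim (_ - _) (0 : EuclideanSpace ℝ (Fin p₁))]
    simp
  have hd1 : ∀ n, 1 ≤ n → 1 ≤ d n := fun n hn => by
    have h := congrFun (congrFun (hΔ n hn) j₀) j₀
    have h0 : 0 ≤ ((Δ n)ᵀ * Δ n) j₀ j₀ := by
      rw [mul_apply]
      exact Finset.sum_nonneg fun i _ => mul_self_nonneg _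
    simp only [Matrix.add_apply, hdiag n hn, Matrix.smul_apply, one_apply_eq, smul_eq_mul,
      mul_one] at h
    linarith
  set η : ℕ → ℝ := fun n => maxEigenvalue
    ((1 : Matrix (Fin p₁) (Fin p₁) ℝ) - (d n)⁻¹ • (normGram (X n)).toBlocks₁₁) with hη
  have hAη : ∀ n, 1 ≤ n →
      ‖(1 : Matrix (Fin p₁) (Fin p₁) ℝ) - (d n)⁻¹ • (normGram (X n)).toBlocks₁₁‖ ≤ η n :=
    fun n hn => by
      refine l2_opNorm_le_maxEigenvalue ?_
      have hd0 : 0 < d n := by linarith [hd1 n hn]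
      have h1 : ((Δ n)ᵀ * Δ n).PosSemidef := posSemidef_conjTranspose_mul_self (Δ n)
      have h2 := (h1.submatrix (Sum.inl : Fin p₁ → _)).smul (inv_nonneg.2 hd0.le)
      rw [eq_sub_of_add_eq' (hΔ n hn)] at h2
      convert h2 using 1
      ext i j
      simp [toBlocks₁₁, one_apply, mul_sub, hd0.ne']
  have hηk : Tendsto (fun n => η n ^ k n) atTop (𝓝 0) := by
    refine (hk.div_atTop hlam₂).congr' ?_
    filter_upwards [hlam₂.eventually_gt_atTop 0] with n hn
    rw [mul_div_assoc, mul_div_cancel_right₀ _ hn.ne']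
  obtain ⟨D, hD⟩ := hd.bound
  have hS₁ := posDef_toBlocks₁₁ hS
  have hX₁ := tendsto_toBlocks₁₁ hX
  have hX₂₁ : Tendsto (fun n => (normGram (X n)).toBlocks₂₁) atTop (𝓝 S.toBlocks₂₁) :=
    ((continuous_id.matrix_submatrix Sum.inr Sum.inl).tendsto S).comp hX
  have hX₂₂ : Tendsto (fun n => (normGram (X n)).toBlocks₂₂) atTop (𝓝 S.toBlocks₂₂) :=
    ((continuous_id.matrix_submatrix Sum.inr Sum.inr).tendsto S).comp hX
  set K := max (‖S⁻¹‖ + 1) (‖S.toBlocks₁₁⁻¹‖ + 1) with hKdef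
  set N := ‖S.toBlocks₂₁‖ + 1 with hNdef
  set M := max D 1 * ‖(1 : Matrix (Fin p₂) (Fin p₂) ℝ)‖ + (‖S.toBlocks₂₂‖ + 1) with hMdef
  have hK0 : 0 < K := lt_max_of_lt_left (by positivity)
  have hN0 : 0 < N := by positivity
  have hD0 : 0 < max D 1 := lt_max_of_lt_right one_pos
  -- Chosen so that `ρ = c λ/n` meets both dead-zone conditions, `D K ρ ≤ λ/n` and `ρ + 3 N K ρ ≤
  -- λ/n`.
  set c := (1 + max D 1 * K + N * (3 * K))⁻¹ with hcdef
  have hc0 : 0 < c := by positivity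
  have hcmul : (1 + max D 1 * K + N * (3 * K)) * c = 1 := mul_inv_cancel₀ (by positivity)
  have hr : Tendsto (fun n : ℕ => c * (lam n / √(n : ℝ))) atTop atTop :=
    hlam₂.const_mul_atTop hc0
  have hδ : Tendsto (fun n => K ^ 2 * √(max D 1 * M) * √(η n ^ k n)) atTop (𝓝 0) := by
    simpa using (hηk.sqrt).const_mul (K ^ 2 * √(max D 1 * M))
  have hβ : ∀ᶠ n : ℕ in atTop, ∀ j : Fin p₁,
      3 * (K * (c * (lam n / n))) + a * (lam n / n) < |β (Sum.inl j)| := by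
    refine eventually_all.2 fun j => ?_
    have h1 : Tendsto (fun n : ℕ => 3 * (K * (c * (lam n / n))) + a * (lam n / n)) atTop
        (𝓝 (3 * (K * (c * 0)) + a * 0)) :=
      (((hlam₁.const_mul c).const_mul K).const_mul 3).add (hlam₁.const_mul a)
    refine h1.eventually_lt_const ?_
    simpa using hβ₁ j
  refine oracleProperty_of_eventually hε hS hX hmeas hr hδ ?_
  filter_upwards [eventually_ge_atTop 1, hD, hβ, hlam₂.eventually_gt_atTop 0,
    hηk.eventually_lt_const one_pos,
    eventually_det_ne_zero hX hS.det_pos.ne', eventually_det_ne_zero hX₁ hS₁.det_pos.ne',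
    eventually_norm_le_norm_add_one (tendsto_matrix_inv hX hS.det_pos.ne'),
    eventually_norm_le_norm_add_one (tendsto_matrix_inv hX₁ hS₁.det_pos.ne'),
    eventually_norm_le_norm_add_one hX₂₁, eventually_norm_le_norm_add_one hX₂₂]
    with n hn hDn hβn hlamn hηkn hdet hdet₁ hKn hK₁n hNn hMn ω hω
  have hn0 : (0 : ℝ) < n := by exact_mod_cast hn
  have hsq : 0 < √(n : ℝ) := Real.sqrt_pos.2 hn0
  have hdn := hd1 n hn
  have hdD : d n ≤ max D 1 := by
    rw [norm_one, mul_one] at hDn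
    exact (le_abs_self _).trans (hDn.trans (le_max_left _ _))
  have hL : lam n / n = lam n / √(n : ℝ) / √(n : ℝ) := by
    rw [div_div, Real.mul_self_sqrt hn0.le]
  have hL0 : 0 ≤ lam n / n := by rw [hL]; positivity
  have hw : ‖WithLp.toLp 2 (scaledScore (X n) (ε n ω).ofLp)‖ ≤ c * (lam n / n) := by
    rw [norm_smul, Real.norm_of_nonneg hsq.le] at hω
    rw [hL, ← mul_div_assoc, le_div_iff₀ hsq, mul_comm]
    exact hω
  have hη0 : 0 ≤ η n := (norm_nonneg _).trans (hAη n hn)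
  -- Since `η^0 = 1` even for `η = 0`, `η^k < 1` guarantees at least one iteration; it likewise
  -- rules out `η > 1`.
  have hk0 : k n ≠ 0 := fun h => by simp [h] at hηkn
  have hη1 : η n ≤ 1 := by
    by_contra hcon
    exact absurd hηkn (not_lt.2 (one_le_pow₀ (not_le.1 hcon).le))
  have hcD : max D 1 * (K * (c * (lam n / n))) ≤ lam n / n := by
    have h1 : max D 1 * K * c ≤ 1 := by
      have : 0 ≤ N * (3 * K) * c := by positivity
      nlinarith
    calc _ = max D 1 * K * c * (lam n / n) := by ring
      _ ≤ _ := mul_le_of_le_one_left hL0 h1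
  have hcN : c * (lam n / n) + N * (3 * (K * (c * (lam n / n)))) ≤ lam n / n := by
    have h1 : c + N * (3 * K) * c ≤ 1 := by
      have : 0 ≤ max D 1 * K * c := by positivity
      nlinarith
    calc _ = (c + N * (3 * K) * c) * (lam n / n) := by ring
      _ ≤ _ := mul_le_of_le_one_left hL0 h1
  have hMn' : ‖((Δ n)ᵀ * Δ n).toBlocks₂₂‖ ≤ M := by
    have h1 : ((Δ n)ᵀ * Δ n).toBlocks₂₂ =
        d n • (1 : Matrix (Fin p₂) (Fin p₂) ℝ) - (normGram (X n)).toBlocks₂₂ := by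
      rw [eq_sub_of_add_eq' (hΔ n hn)]
      ext i j
      simp [toBlocks₂₂, one_apply]
    rw [h1]
    refine (norm_sub_le _ _).trans (add_le_add ?_ hMn)
    rw [norm_smul, Real.norm_of_nonneg (by linarith)]
    gcongr
  obtain ⟨i, hi⟩ := Nat.exists_eq_succ_of_ne_zero hk0
  have hseq := oemSeq_succ_eq (hs₁ n hL0 hdn) (hs₂ n hL0 hdn) (by omega) hdn hdD (hΔ n hn) hdet
    hdet₁ (hKn.trans (le_max_left _ _)) (hK₁n.trans (le_max_right _ _)) hNn
    ((hAη n hn).trans hη1) hβ₂ hw hcD hcN hβn i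
  have hols := norm_ols_sub_oracle_le hdn hdD (hΔ n hn) hdet hdet₁
    (hKn.trans (le_max_left _ _)) (hK₁n.trans (le_max_right _ _)) hMn' (hAη n hn)
    (scaledScore (X n) (ε n ω).ofLp)
  rw [hi, Nat.succ_eq_add_one, hseq]
  refine ⟨fun j => by simp [hβ₂], ?_⟩
  rw [← smul_sub, norm_smul, norm_smul, Real.norm_of_nonneg hsq.le, ← WithLp.toLp_sub]
  have hpow := norm_toLp_pow_mulVec_le (hAη n hn) i
    (((normGram (X n))⁻¹ *ᵥ scaledScore (X n) (ε n ω).ofLp) ∘ Sum.inl -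
      (normGram (X n)).toBlocks₁₁⁻¹ *ᵥ (scaledScore (X n) (ε n ω).ofLp ∘ Sum.inl))
  -- Squaring gives `η^(2i+1) ≤ η^(i+1)`, valid for `0 ≤ η ≤ 1`; without `√η`, `η^(i+1) → 0` would
  -- not force `η^i → 0`.
  have hsqrt : η n ^ i * √(η n) ≤ √(η n ^ (i + 1)) := by
    refine Real.le_sqrt_of_sq_le ?_
    rw [mul_pow, Real.sq_sqrt hη0, ← pow_mul, ← pow_succ]
    exact pow_le_pow_of_le_one hη0 hη1 (by omega)
  have heq : ∀ (u v : Fin p₁ → ℝ), (fun j => (β + Sum.elim (u + v) (0 : Fin p₂ → ℝ)) (Sum.inl j) -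
      β (Sum.inl j)) - u = v := fun u v => by ext j; simp
  rw [heq]
  set w := scaledScore (X n) (ε n ω).ofLp with hwdef
  calc _ ≤ √(n : ℝ) * (η n ^ i * (K ^ 2 * √(max D 1 * M) * √(η n) * ‖WithLp.toLp 2 w‖)) := by
        gcongr
        exact hpow.trans (by gcongr)
    _ = K ^ 2 * √(max D 1 * M) * (η n ^ i * √(η n)) * (√(n : ℝ) * ‖WithLp.toLp 2 w‖) := by ring
    _ ≤ _ := by gcongr

end

theorem theorem1 {p₁ p₂ : ℕ}
    -- For each sample size, a probability space with the Gaussian error vector.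
    {Ω : ℕ → Type*} [∀ n, MeasurableSpace (Ω n)]
    (P : ∀ n, Measure (Ω n)) [∀ n, IsProbabilityMeasure (P n)]
    (σ : ℝ) (hσ : 0 < σ)
    (ε : ∀ n, Ω n → EuclideanSpace ℝ (Fin n))
    (hε : ∀ n, HasLaw (ε n)
      (multivariateGaussian 0 (σ ^ 2 • (1 : Matrix (Fin n) (Fin n) ℝ))) (P n))
    -- The true coefficients.
    (β : Fin p₁ ⊕ Fin p₂ → ℝ)
    (hβ₁ : ∀ j, β (Sum.inl j) ≠ 0) (hβ₂ : ∀ j, β (Sum.inr j) = 0)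
    -- The regression matrices, their limiting Gram matrix, and the orthogonal completion.
    (X : ∀ n, Matrix (Fin n) (Fin p₁ ⊕ Fin p₂) ℝ)
    (S : Matrix (Fin p₁ ⊕ Fin p₂) (Fin p₁ ⊕ Fin p₂) ℝ) (hS : S.PosDef)
    (hX : Tendsto (fun n => normGram (X n)) atTop (𝓝 S))
    (hdiag : ∀ n, 1 ≤ n → ∀ j, normGram (X n) j j = 1)
    (m : ℕ → ℕ) (Δ : ∀ n, Matrix (Fin (m n)) (Fin p₁ ⊕ Fin p₂) ℝ)
    (d : ℕ → ℝ)
    (hΔ : ∀ n, 1 ≤ n → normGram (X n) + (Δ n)ᵀ * Δ n =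
      d n • (1 : Matrix (Fin p₁ ⊕ Fin p₂) (Fin p₁ ⊕ Fin p₂) ℝ))
    (hdγ : ∀ n, 1 ≤ n → maxEigenvalue (normGram (X n)) ≤ d n)
    (hd : d =O[atTop] fun _ => (1 : ℝ))
    -- The tuning parameters.
    (lam : ℕ → ℝ)
    (hlam₁ : Tendsto (fun n : ℕ => lam n / n) atTop (𝓝 0))
    (hlam₂ : Tendsto (fun n : ℕ => lam n / √(n : ℝ)) atTop atTop)
    -- The iteration counts.
    (k : ℕ → ℕ)
    (hk₁ : Tendsto (fun n : ℕ =>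
      maxEigenvalue ((1 : Matrix (Fin p₁) (Fin p₁) ℝ) - (d n)⁻¹ • (normGram (X n)).toBlocks₁₁) ^ k n
        * lam n / √(n : ℝ)) atTop (𝓝 0))
    (hk₂ : ∀ c : ℝ, 0 < c → Tendsto (fun n : ℕ =>
      (k n : ℝ) ^ 2 * Real.exp (-c * (lam n / √(n : ℝ)) ^ 2)) atTop (𝓝 0)) :
    -- SCAD
    (∀ a : ℝ, 2 < a → OracleProperty P S σ β (fun n ω =>
      oemSeq (scadUpdate a (lam n / n) (d n)) (X n) (Δ n) (X n *ᵥ β + (ε n ω).ofLp) (k n))) ∧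
    -- MCP
    (∀ a : ℝ, 1 < a → OracleProperty P S σ β (fun n ω =>
      oemSeq (mcpUpdate a (lam n / n) (d n)) (X n) (Δ n) (X n *ᵥ β + (ε n ω).ofLp) (k n))) := by

  refine ⟨fun a ha => ?_, fun a ha => ?_⟩
  · exact oracleProperty_oemSeq hε hβ₁ hβ₂ hS hX hdiag hΔ hd hlam₁ hlam₂ hk₁
      (fun n => measurable_scadUpdate a _ _) (fun n hL hd u hu => scadUpdate_of_abs_le hL hd hu)
      (fun n hL hd u hu => scadUpdate_of_lt_abs ha hL hd hu)
  · exact oracleProperty_oemSeq hε hβ₁ hβ₂ hS hX hdiag hΔ hd hlam₁ hlam₂ hk₁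
      (fun n => measurable_mcpUpdate a _ _) (fun n hL hd u hu => mcpUpdate_of_abs_le ha hL hd hu)
      (fun n hL hd u hu => mcpUpdate_of_lt_abs hu)
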